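/- For a nonnegative integer $m$ let $$P_m(a)=\sum_{j=0}^{m}\sum_{k=0}^{m-j}\binom{2m+1}{2j}\binom{m-j}{k}\binom{2k+2j}{k+j}\frac{(a+1)^j(a-1)^k}{2^{3(k+j)}}$$ be the Boros--Moll polynomial, and let $d_i(m)$ be the coefficient of $a^i$ in $P_m(a)$ (so $d_i(m)=0$ for $i>m$). Let $m\ge 2$ and, for $1\le i\le m$, put $$c_i=i(i+1)\bigl(d_i(m)^2-d_{i-1}(m)\,d_{i+1}(m)\bigr).$$ Then: 1. The sequence $\{c_i\}_{1\le i\le m}$ is log-concave, i.e. $c_i^2\ge c_{i-1}c_{i+1}$ for $1\le i\le m$, with the convention $c_0=c_{m+1}=0$. 2. The sequence $\{c_i\}_{1\le i\le m}$ is unimodal, i.e. there is an index $1\le j\le m$ with $c_1\le\cdots\le c_j\ge\cdots\ge c_m$. 3. The sequence attains its minimum at $i=m$ (Moll's minimum conjecture), i.e. $c_m\le c_i$ for all $1\le i\le m$, and the minimum value is $c_m=2^{-2m}\,m(m+1)\binom{2m}{m}^2$. -/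

import Mathlib

noncomputable section

/-- The Boros-Moll polynomial
`P_m(a) = ∑_{j,k} C(2m+1,2j) C(m-j,k) C(2k+2j,k+j) (a+1)^j (a-1)^k / 2^{3(k+j)}`.
The sum runs over `0 ≤ j ≤ m` and `0 ≤ k ≤ m - j`; all other terms vanish. -/
def borosMollPoly (m : ℕ) : Polynomial ℝ :=
  ∑ j ∈ Finset.range (m + 1), ∑ k ∈ Finset.range (m - j + 1),
    Polynomial.C
      (((2 * m + 1).choose (2 * j) : ℝ) * ((m - j).choose k : ℝ)
        * ((2 * k + 2 * j).choose (k + j) : ℝ) / 2 ^ (3 * (k + j)))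
      * (Polynomial.X + 1) ^ j * (Polynomial.X - 1) ^ k

/-- `d_i(m)`, the coefficient of `a^i` in `P_m(a)` (so it is `0` for `i > m`). -/
def borosMollCoeff (m i : ℕ) : ℝ := (borosMollPoly m).coeff i

/-- The sequence `i (i+1) (d_i(m)^2 - d_{i-1}(m) d_{i+1}(m))`, which is used for `1 ≤ i ≤ m`. -/
def mollSeq (m i : ℕ) : ℝ :=
  (i : ℝ) * ((i : ℝ) + 1) *
    (borosMollCoeff m i ^ 2 - borosMollCoeff m (i - 1) * borosMollCoeff m (i + 1))

/-- The finite sequence `{a_i}_{p ≤ i ≤ q}`, extended by zero outside its range of indices. -/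
def zeroExtend (p q : ℕ) (a : ℕ → ℝ) (i : ℕ) : ℝ :=
  if p ≤ i ∧ i ≤ q then a i else 0

/-- The finite sequence `{a_i}_{p ≤ i ≤ q}` is log-concave: `a_{i-1} a_{i+1} ≤ a_i^2` for
`p ≤ i ≤ q`, where `a_{p-1} = a_{q+1} = 0`. The central index is written `i + 1`;
the index `0` (relevant only for `p = 0`) gives the trivial condition `0 ≤ a_0^2`. -/
def IsLogConcaveSeq (p q : ℕ) (a : ℕ → ℝ) : Prop :=
  ∀ i : ℕ, p ≤ i + 1 → i + 1 ≤ q →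
    zeroExtend p q a i * zeroExtend p q a (i + 2) ≤ zeroExtend p q a (i + 1) ^ 2

/-- The finite sequence `{a_i}_{p ≤ i ≤ q}` is unimodal: there is `j` with `p ≤ j ≤ q` and
`a_p ≤ ⋯ ≤ a_j ≥ ⋯ ≥ a_q`. -/
def IsUnimodalSeq (p q : ℕ) (a : ℕ → ℝ) : Prop :=
  ∃ j : ℕ, p ≤ j ∧ j ≤ q ∧
    (∀ i : ℕ, p ≤ i → i < j → a i ≤ a (i + 1)) ∧
    (∀ i : ℕ, j ≤ i → i < q → a (i + 1) ≤ a i)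

end

/-! The double sum for $P_m$ is hypergeometric in both indices. A telescoping certificate turns this
into the differential equation $(1-a^2)P''-(2m+1+2a)P'+m(m+1)P=0$, hence into a three-term
recurrence for the $d_i$. Together with $d_{m+1}=0$ and the explicit value of $d_m$, this recurrence
governs the coefficients.

Descending induction on the recurrence confines $d_{i-1}/d_i$ to
$[\frac{2i}{2m-i},\frac{2i+1}{2(m-i+1)}]$ (`borosMollCoeff_ratio_bounds`). It then gives strict
log-concavity of the $d_i$, that is, $c_i>0$.

For $2\le i\le m-1$ the recurrence expresses $d_{i-2}$, $d_{i+1}$, $d_{i+2}$ through $x=d_i$ and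
$y=d_{i-1}$, so $c_{i-1}c_{i+1}\le c_i^2$ says that a quartic form in $x,y$ is nonnegative. The
ratio bounds place $(x,y)$ in a cone. In coordinates along which the cone is a quadrant, all five
coefficients of the form are nonnegative (`moll_quartic_nonneg`). The extreme indices are trivial
because $c_0=c_{m+1}=0$.

A positive log-concave sequence is unimodal, and a unimodal sequence is minimal at one of its ends.
It remains to see $c_m\le c_1$. The recurrence makes $c_1$ a quadratic form in $d_0,d_1$, bounded
below by a multiple of $d_0^2$, and $d_0\ge\frac32 d_m$ follows from expanding $P_m$ in powers of
$a+1$. -/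

/-! ### Term ratios of the double sum -/

/-- The term of index `(j, k)` of the Boros-Moll polynomial, without its powers of `X ± 1`. -/
noncomputable def borosMollTerm (m j k : ℕ) : ℝ :=
  ((2 * m + 1).choose (2 * j) : ℝ) * ((m - j).choose k : ℝ)
    * ((2 * k + 2 * j).choose (k + j) : ℝ) / 2 ^ (3 * (k + j))

/-- The vanishing of terms outside the triangle $j+k\le m$ allows summation over a full square,
where index shifts leave no boundary terms. -/
theorem borosMollTerm_of_lt_left {m j : ℕ} (k : ℕ) (h : m < j) : borosMollTerm m j k = 0 := by
  simp [borosMollTerm, Nat.choose_eq_zero_of_lt (show 2 * m + 1 < 2 * j by omega)]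

theorem borosMollTerm_of_lt_right {m j k : ℕ} (h : m - j < k) : borosMollTerm m j k = 0 := by
  simp [borosMollTerm, Nat.choose_eq_zero_of_lt h]

theorem borosMollPoly_eq (m : ℕ) :
    borosMollPoly m = ∑ j ∈ Finset.range (m + 1), ∑ k ∈ Finset.range (m + 1),
      Polynomial.C (borosMollTerm m j k) * ((Polynomial.X + 1) ^ j * (Polynomial.X - 1) ^ k) := by
  unfold borosMollPoly
  refine Finset.sum_congr rfl fun j _ => ?_
  rw [← Finset.sum_subset (Finset.range_mono (show m - j + 1 ≤ m + 1 by omega))]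
  · exact Finset.sum_congr rfl fun k _ => by rw [borosMollTerm, mul_assoc]
  · intro k _ hk
    rw [borosMollTerm_of_lt_right (by simpa using hk)]
    simp

theorem choose_two_mul_succ (m j : ℕ) (hj : j ≤ m) :
    ((2 * m + 1).choose (2 * (j + 1)) : ℝ) * ((2 * j + 1) * (j + 1)) =
      ((2 * m + 1).choose (2 * j) : ℝ) * ((2 * m + 1 - 2 * j) * (m - j)) := by
  have h1 := Nat.choose_succ_right_eq (2 * m + 1) (2 * j)
  have h2 := Nat.choose_succ_right_eq (2 * m + 1) (2 * j + 1)
  have e1 : 2 * m + 1 - 2 * j = 2 * (m - j) + 1 := by omega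
  have e2 : 2 * m + 1 - (2 * j + 1) = 2 * (m - j) := by omega
  rw [e1] at h1
  rw [e2] at h2
  have h1' := congrArg (Nat.cast (R := ℝ)) h1
  have h2' := congrArg (Nat.cast (R := ℝ)) h2
  push_cast [Nat.cast_sub hj] at h1' h2'
  rw [show 2 * (j + 1) = 2 * j + 1 + 1 by ring]
  linear_combination (2 * (j : ℝ) + 1) / 2 * h2' + ((m : ℝ) - j) * h1'

theorem centralBinom_moment_succ (s : ℕ) :
    4 * ((s : ℝ) + 1) * (((2 * (s + 1)).choose (s + 1) : ℝ) / 2 ^ (3 * (s + 1))) =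
      (2 * s + 1) * (((2 * s).choose s : ℝ) / 2 ^ (3 * s)) := by
  have h := congrArg (Nat.cast (R := ℝ)) (Nat.succ_mul_centralBinom_succ s)
  simp only [Nat.centralBinom_eq_two_mul_choose] at h
  push_cast at h
  rw [show 3 * (s + 1) = 3 * s + 3 by ring, pow_add]
  field_simp
  linear_combination 4 * h

theorem cast_sub_mul_choose (n k : ℕ) :
    ((n : ℝ) + 1) * (n.choose k : ℝ) = (n + 1 - k) * ((n + 1).choose k : ℝ) := by
  rcases le_or_gt k (n + 1) with hk | hk
  · have h := congrArg (Nat.cast (R := ℝ)) (Nat.choose_mul_succ_eq n k)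
    push_cast [Nat.cast_sub hk] at h
    linarith
  · simp [Nat.choose_eq_zero_of_lt hk, Nat.choose_eq_zero_of_lt (show n < k by omega)]

theorem cast_choose_succ_right (n k : ℕ) :
    (n.choose (k + 1) : ℝ) * (k + 1) = (n.choose k : ℝ) * (n - k) := by
  rcases le_or_gt k n with hk | hk
  · have h := congrArg (Nat.cast (R := ℝ)) (Nat.choose_succ_right_eq n k)
    push_cast [Nat.cast_sub hk] at h
    exact h
  · simp [Nat.choose_eq_zero_of_lt hk, Nat.choose_eq_zero_of_lt (show n < k + 1 by omega)]

theorem borosMollTerm_succ_left (m j k : ℕ) :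
    4 * ((j : ℝ) + k + 1) * ((2 * j + 1) * (j + 1)) * borosMollTerm m (j + 1) k =
      (2 * (j + k) + 1) * ((2 * m + 1 - 2 * j) * (m - j - k)) * borosMollTerm m j k := by
  rcases lt_trichotomy m j with hj | rfl | hj
  · simp [borosMollTerm_of_lt_left k hj, borosMollTerm_of_lt_left k (show m < j + 1 by omega)]
  · rw [borosMollTerm_of_lt_left k (Nat.lt_succ_self m)]
    rcases k with _ | k
    · simp
    · simp [borosMollTerm_of_lt_right (show m - m < k + 1 by omega)]
  · obtain ⟨n, rfl⟩ : ∃ n, m = j + 1 + n := ⟨m - (j + 1), by omega⟩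
    have h1 := choose_two_mul_succ (j + 1 + n) j (by omega)
    have h2 := centralBinom_moment_succ (k + j)
    have h3 := cast_sub_mul_choose n k
    unfold borosMollTerm
    rw [show j + 1 + n - (j + 1) = n by omega, show j + 1 + n - j = n + 1 by omega,
      ← mul_add 2 k (j + 1), ← mul_add 2 k j, ← add_assoc k j 1]
    push_cast at h1 h2 ⊢
    generalize (((2 * (j + 1 + n) + 1).choose (2 * (j + 1)) : ℕ) : ℝ) = c at h1 ⊢
    generalize (((2 * (j + 1 + n) + 1).choose (2 * j) : ℕ) : ℝ) = c' at h1 ⊢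
    generalize (((2 * (k + j + 1)).choose (k + j + 1) : ℕ) : ℝ) = u at h2 ⊢
    generalize (((2 * (k + j)).choose (k + j) : ℕ) : ℝ) = u' at h2 ⊢
    generalize ((n.choose k : ℕ) : ℝ) = w at h3 ⊢
    generalize (((n + 1).choose k : ℕ) : ℝ) = w' at h3 ⊢
    rw [mul_div_assoc, mul_div_assoc]
    generalize u / 2 ^ (3 * (k + j + 1)) = v at h2 ⊢
    generalize u' / 2 ^ (3 * (k + j)) = v' at h2 ⊢
    linear_combination (c * w) * ((2 * j + 1) * (j + 1)) * h2
      + (2 * ((k : ℝ) + j) + 1) * v' * w * h1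
      + (2 * ((k : ℝ) + j) + 1) * v' * c' * (2 * n + 3) * h3

theorem borosMollTerm_succ_right (m j k : ℕ) :
    4 * ((j : ℝ) + k + 1) * (k + 1) * borosMollTerm m j (k + 1) =
      (2 * (j + k) + 1) * (m - j - k) * borosMollTerm m j k := by
  rcases lt_or_ge m j with hj | hj
  · simp [borosMollTerm_of_lt_left _ hj]
  · have h1 := cast_choose_succ_right (m - j) k
    have h2 := centralBinom_moment_succ (k + j)
    unfold borosMollTerm
    rw [← mul_add 2 (k + 1) j, ← mul_add 2 k j, add_right_comm k 1 j, mul_div_assoc, mul_div_assoc]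
    push_cast [Nat.cast_sub hj] at h1 h2 ⊢
    generalize (((2 * m + 1).choose (2 * j) : ℕ) : ℝ) = c at *
    generalize (((2 * (k + j + 1)).choose (k + j + 1) : ℕ) : ℝ) / 2 ^ (3 * (k + j + 1)) = v at *
    generalize (((2 * (k + j)).choose (k + j) : ℕ) : ℝ) / 2 ^ (3 * (k + j)) = v' at *
    linear_combination c * ((m - j).choose (k + 1) : ℝ) * (k + 1) * h2
      + (2 * ((k : ℝ) + j) + 1) * v' * c * h1

/-! ### The differential equation -/

theorem sum_range_eq_sum_range_shift (f : ℕ → ℝ) (n : ℕ) (h0 : f 0 = 0) (hn : f n = 0) :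
    ∑ j ∈ Finset.range n, f j = ∑ j ∈ Finset.range n, f (j + 1) := by
  have h1 := Finset.sum_range_succ f n
  have h2 := Finset.sum_range_succ' f n
  linarith

/-- The differential equation of the Boros-Moll polynomial at `a = p - 1 = q + 1`, multiplied by
`p q`, in terms of the double sum. -/
theorem sum_borosMollTerm_mul (m : ℕ) (p q : ℝ) (hpq : p - q = 2) :
    ∑ j ∈ Finset.range (m + 1), ∑ k ∈ Finset.range (m + 1),
      borosMollTerm m j k * (p ^ j * q ^ k) *
        (j * (m + 1 / 2 - j) * q ^ 2
          + (m * (m + 1) - 2 * j * k - (m + 3 / 2) * j + (m - 1 / 2) * k) * (p * q)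
          - k * (m + 1 / 2 + k) * p ^ 2) = 0 := by
  set T := borosMollTerm m with hT
  -- `U` and `V` form a telescoping certificate, `U` in the direction of $k$ and `V` in that of $j$.
  -- One is needed because the products $p^jq^k$ are linearly dependent when $p-q=2$, so the terms
  -- do not cancel monomial by monomial.
  let U : ℕ → ℕ → ℝ := fun j k => T j k * k / (2 * j + 1)
    * (((2 * m - 2 * j) ^ 2 - 1) / 2 - 2 * (j + k) * (m + 1))
  let V : ℕ → ℕ → ℝ := fun j k => T j k * j * (1 / 2 + k)
  have T1 : ∀ k, T (m + 1) k = 0 := fun k => borosMollTerm_of_lt_left k (Nat.lt_succ_self m)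
  have T2 : ∀ j, T j (m + 1) = 0 := fun j => borosMollTerm_of_lt_right (by omega)
  have S1 : ∑ j ∈ Finset.range (m + 1), ∑ k ∈ Finset.range (m + 1),
        T j k * (j * (m + 1 / 2 - j)) * (p ^ j * q ^ (k + 2)) =
      ∑ j ∈ Finset.range (m + 1), ∑ k ∈ Finset.range (m + 1),
        T (j + 1) k * ((j + 1) * (m - 1 / 2 - j)) * (p ^ (j + 1) * q ^ (k + 2)) := by
    rw [sum_range_eq_sum_range_shift _ _ (by simp) (by simp [T1])]
    refine Finset.sum_congr rfl fun j _ => Finset.sum_congr rfl fun k _ => ?_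
    push_cast
    ring
  have S2 : ∑ j ∈ Finset.range (m + 1), ∑ k ∈ Finset.range (m + 1),
        T j k * (k * (m + 1 / 2 + k)) * (p ^ (j + 2) * q ^ k) =
      ∑ j ∈ Finset.range (m + 1), ∑ k ∈ Finset.range (m + 1),
        T j (k + 1) * ((k + 1) * (m + 3 / 2 + k)) * (p ^ (j + 2) * q ^ (k + 1)) := by
    refine Finset.sum_congr rfl fun j _ => ?_
    rw [sum_range_eq_sum_range_shift _ _ (by simp) (by simp [T2])]
    refine Finset.sum_congr rfl fun k _ => ?_
    push_cast
    ring
  have S3 : ∑ j ∈ Finset.range (m + 1), ∑ k ∈ Finset.range (m + 1),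
        U j k * (p ^ (j + 1) * q ^ (k + 1)) =
      ∑ j ∈ Finset.range (m + 1), ∑ k ∈ Finset.range (m + 1),
        U j (k + 1) * (p ^ (j + 1) * q ^ (k + 2)) := by
    refine Finset.sum_congr rfl fun j _ => ?_
    rw [sum_range_eq_sum_range_shift _ _ (by simp [U]) (by simp [U, T2])]
  have S4 : ∑ j ∈ Finset.range (m + 1), ∑ k ∈ Finset.range (m + 1),
        V j k * (p ^ (j + 1) * q ^ (k + 1)) =
      ∑ j ∈ Finset.range (m + 1), ∑ k ∈ Finset.range (m + 1),
        V (j + 1) k * (p ^ (j + 2) * q ^ (k + 1)) := by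
    rw [sum_range_eq_sum_range_shift _ _ (by simp [V]) (by simp [V, T1])]
  have key : ∀ j k : ℕ,
      T (j + 1) k * ((j + 1) * (m - 1 / 2 - j)) * (p ^ (j + 1) * q ^ (k + 2))
        + T j k * (m * (m + 1) - 2 * j * k - (m + 3 / 2) * j + (m - 1 / 2) * k)
          * (p ^ (j + 1) * q ^ (k + 1))
        - T j (k + 1) * ((k + 1) * (m + 3 / 2 + k)) * (p ^ (j + 2) * q ^ (k + 1)) =
      U j (k + 1) * (p ^ (j + 1) * q ^ (k + 2)) + V (j + 1) k * (p ^ (j + 2) * q ^ (k + 1))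
        - U j k * (p ^ (j + 1) * q ^ (k + 1)) - V j k * (p ^ (j + 1) * q ^ (k + 1)) := by
    intro j k
    have hs : (j : ℝ) + k + 1 ≠ 0 := by positivity
    have hj : (2 * (j : ℝ) + 1) ≠ 0 := by positivity
    have hj' : (j : ℝ) + 1 ≠ 0 := by positivity
    have hk' : (k : ℝ) + 1 ≠ 0 := by positivity
    have e1 : T (j + 1) k = (2 * (j + k) + 1) * ((2 * m + 1 - 2 * j) * (m - j - k)) * T j k
        / (4 * ((j : ℝ) + k + 1) * ((2 * j + 1) * (j + 1))) := by
      rw [eq_div_iff (by positivity), ← borosMollTerm_succ_left]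
      ring
    have e2 : T j (k + 1) = (2 * (j + k) + 1) * (m - j - k) * T j k
        / (4 * ((j : ℝ) + k + 1) * (k + 1)) := by
      rw [eq_div_iff (by positivity), ← borosMollTerm_succ_right]
      ring
    have hp : p = q + 2 := by linarith
    -- After subtraction of the certificate, the coefficients of $p^{j+1}q^{k+2}$, $p^{j+2}q^{k+1}$
    -- and $p^{j+1}q^{k+1}$ are $e$, $-e$ and $2e$ for a common $e$. The remainder is
    -- $e\,p^{j+1}q^{k+1}(q-p+2)=0$.
    have c1 : T (j + 1) k * ((j + 1) * (m - 1 / 2 - j)) - U j (k + 1) =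
        (2 * (j + k) + 1) / 2 * (m + 1) * (m - j - k) * T j k / (2 * j + 1) := by
      simp only [U, e1, e2]
      push_cast
      field_simp
      ring
    have c2 : - (T j (k + 1) * ((k + 1) * (m + 3 / 2 + k))) - V (j + 1) k =
        - ((2 * (j + k) + 1) / 2 * (m + 1) * (m - j - k) * T j k / (2 * j + 1)) := by
      simp only [V, e1, e2]
      push_cast
      field_simp
      ring
    have c3 : T j k * (m * (m + 1) - 2 * j * k - (m + 3 / 2) * j + (m - 1 / 2) * k)
        + U j k + V j k =
        (2 * (j + k) + 1) * (m + 1) * (m - j - k) * T j k / (2 * j + 1) := by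
      simp only [U, V]
      field_simp
      ring
    rw [hp] at *
    linear_combination ((q + 2) ^ (j + 1) * q ^ (k + 2)) * c1
      + ((q + 2) ^ (j + 2) * q ^ (k + 1)) * c2 + ((q + 2) ^ (j + 1) * q ^ (k + 1)) * c3
  have tot := Finset.sum_congr (rfl : Finset.range (m + 1) = _) fun j _ =>
    Finset.sum_congr (rfl : Finset.range (m + 1) = _) fun k _ => key j k
  simp only [Finset.sum_add_distrib, Finset.sum_sub_distrib] at tot
  rw [← S1, ← S2, ← S3, ← S4] at tot
  rw [add_sub_cancel_left, sub_self] at tot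
  rw [← tot]
  simp only [← Finset.sum_add_distrib, ← Finset.sum_sub_distrib]
  refine Finset.sum_congr rfl fun j _ => Finset.sum_congr rfl fun k _ => ?_
  ring

section
open Polynomial

theorem mul_derivative_X_add_C_pow (c : ℝ) (j : ℕ) :
    (X + C c) * derivative ((X + C c) ^ j) = C (j : ℝ) * (X + C c) ^ j := by
  rcases j with _ | j
  · simp
  · rw [derivative_X_add_C_pow]
    simp only [map_natCast, Nat.add_sub_cancel]
    ring

/-- The action on `(X + 1) ^ j * (X - 1) ^ k` of the differential operator of the Boros-Moll
polynomial. -/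
theorem borosMoll_operator_monomial (m : ℝ) (j k : ℕ) (a : ℝ) :
    let y : ℝ[X] := (X + 1) ^ j * (X - 1) ^ k
    ((a + 1) * (a - 1)) *
      ((1 - a ^ 2) * (derivative (derivative y)).eval a
        - (2 * m + 1 + 2 * a) * (derivative y).eval a + m * (m + 1) * y.eval a) =
      ((a + 1) ^ j * (a - 1) ^ k) *
        (j * (m + 1 / 2 - j) * (a - 1) ^ 2
          + (m * (m + 1) - 2 * j * k - (m + 3 / 2) * j + (m - 1 / 2) * k) * ((a + 1) * (a - 1))
          - k * (m + 1 / 2 + k) * (a + 1) ^ 2) := by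
  intro y
  have hP := mul_derivative_X_add_C_pow 1 j
  have hQ := mul_derivative_X_add_C_pow (-1) k
  have hP' := congrArg derivative hP
  have hQ' := congrArg derivative hQ
  simp only [derivative_mul, derivative_add, derivative_X, derivative_C, add_zero, one_mul,
    zero_mul, zero_add] at hP' hQ'
  have hP := congrArg (eval a) hP
  have hQ := congrArg (eval a) hQ
  have hP' := congrArg (eval a) hP'
  have hQ' := congrArg (eval a) hQ'
  have hy : y = (X + C 1) ^ j * (X + C (-1)) ^ k := by
    simp [y, sub_eq_add_neg]
  rw [hy]
  simp only [derivative_mul, derivative_add]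
  simp only [eval_add, eval_mul, eval_pow, eval_X, eval_C] at hP hQ hP' hQ' ⊢
  generalize eval a (derivative (derivative ((X + C (1 : ℝ)) ^ j))) = p2 at *
  generalize eval a (derivative (derivative ((X + C (-1 : ℝ)) ^ k))) = q2 at *
  generalize eval a (derivative ((X + C (1 : ℝ)) ^ j)) = p1 at *
  generalize eval a (derivative ((X + C (-1 : ℝ)) ^ k)) = q1 at *
  rw [← sub_eq_add_neg] at *
  generalize (a + 1) ^ j = p0 at *
  generalize (a - 1) ^ k = q0 at *
  -- Applying the Euler operator $(X+c)\,d/dX$ twice gives the second derivatives without the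
  -- exponents $j-2$, $k-2$.
  have hp2 : (a + 1) ^ 2 * p2 = (j - 1) * j * p0 := by
    linear_combination (a + 1) * hP' + (j - 1) * hP
  have hq2 : (a - 1) ^ 2 * q2 = (k - 1) * k * q0 := by
    linear_combination (a - 1) * hQ' + (k - 1) * hQ
  linear_combination -(a - 1) ^ 2 * q0 * hp2 - (a + 1) ^ 2 * p0 * hq2
    - 2 * (a + 1) * (a - 1) * ((a - 1) * q1 * hP + j * p0 * hQ)
    - (2 * m + 1 + 2 * a) * ((a - 1) * q0 * hP + (a + 1) * p0 * hQ)

theorem borosMollPoly_ode (m : ℕ) :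
    (1 - X ^ 2) * derivative (derivative (borosMollPoly m))
      - C ((2 * m + 1 : ℝ)) * derivative (borosMollPoly m)
      - 2 * X * derivative (borosMollPoly m)
      + C ((m : ℝ) * (m + 1)) * borosMollPoly m = 0 := by
  -- The operator lowers the exponents of $a\pm1$ by up to two. The factor $(a+1)(a-1)$ keeps the
  -- monomial identity polynomial in $a\pm1$, and is cancelled here.
  have hne : ((X + C (1 : ℝ)) * (X + C (-1 : ℝ))) ≠ 0 :=
    mul_ne_zero (X_add_C_ne_zero _) (X_add_C_ne_zero _)
  refine (mul_eq_zero.mp ?_).resolve_left hne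
  refine Polynomial.funext fun a => ?_
  have h := sum_borosMollTerm_mul m (a + 1) (a - 1) (by ring)
  have e : ∀ j k : ℕ, _ := fun j k => borosMoll_operator_monomial m j k a
  simp only [mul_assoc (borosMollTerm m _ _), ← e] at h
  rw [eval_zero, ← h, borosMollPoly_eq]
  simp only [derivative_sum, derivative_C_mul, eval_mul, eval_add, eval_sub, eval_X, eval_C,
    eval_pow, eval_one, eval_finsetSum, eval_ofNat, Finset.mul_sum, ← Finset.sum_add_distrib,
    ← Finset.sum_sub_distrib]
  refine Finset.sum_congr rfl fun j _ => Finset.sum_congr rfl fun k _ => ?_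
  ring

/-! ### The recurrence and the leading coefficient -/

theorem borosMollCoeff_recurrence_shift (m n : ℕ) :
    ((n : ℝ) + 1) * (n + 2) * borosMollCoeff m (n + 2)
      - (2 * m + 1) * (n + 1) * borosMollCoeff m (n + 1)
      + (m - n) * (m + n + 1) * borosMollCoeff m n = 0 := by
  have h := congrArg (fun P => coeff P n) (borosMollPoly_ode m)
  have h1 : ∀ P : ℝ[X], (X * derivative P).coeff n = n * P.coeff n := by
    intro P
    rcases n with _ | n
    · simp
    · rw [coeff_X_mul, coeff_derivative]
      push_cast
      ring
  have h2 : ∀ P : ℝ[X], (X ^ 2 * derivative (derivative P)).coeff n = n * (n - 1) * P.coeff n := by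
    intro P
    have e : X ^ 2 * derivative (derivative P) =
        X * derivative (X * derivative P) - X * derivative P := by
      simp only [derivative_mul, derivative_X]
      ring
    rw [e, coeff_sub, h1, h1]
    ring
  have e : ∀ P Q R S : ℝ[X], ∀ c d : ℝ, (1 - X ^ 2) * P - C c * Q - 2 * X * R + C d * S =
      P - X ^ 2 * P - C c * Q - C 2 * (X * R) + C d * S := by
    intro P Q R S c d
    rw [map_ofNat]
    ring
  simp only [e, coeff_add, coeff_sub, coeff_C_mul, h1, h2, coeff_derivative, coeff_zero] at h
  unfold borosMollCoeff
  push_cast at h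
  rw [show n + 1 + 1 = n + 2 by ring] at h
  linear_combination h

theorem borosMollCoeff_of_lt {m i : ℕ} (h : m < i) : borosMollCoeff m i = 0 := by
  unfold borosMollCoeff borosMollPoly
  rw [finsetSum_coeff]
  refine Finset.sum_eq_zero fun j hj => ?_
  rw [finsetSum_coeff]
  refine Finset.sum_eq_zero fun k hk => ?_
  refine coeff_eq_zero_of_natDegree_lt (lt_of_le_of_lt ?_ h)
  simp only [Finset.mem_range] at hj hk
  rw [mul_assoc]
  refine (natDegree_C_mul_le _ _).trans (natDegree_mul_le.trans ?_)
  have h1 := natDegree_pow_X_add_C (R := ℝ) j 1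
  have h2 := natDegree_pow_X_add_C (R := ℝ) k (-1)
  simp only [map_one, map_neg, ← sub_eq_add_neg] at h1 h2
  rw [h1, h2]
  omega

/-- Pascal's rule splits each $\binom{2m+1}{2j}$ into two neighbours of row $2m$, so the partial
sums are partial sums of that row. -/
theorem sum_choose_two_mul (m : ℕ) :
    ∑ j ∈ Finset.range (m + 1), ((2 * m + 1).choose (2 * j) : ℝ) = 4 ^ m := by
  have h : ∀ n, ∑ j ∈ Finset.range (n + 1), (2 * m + 1).choose (2 * j) =
      ∑ i ∈ Finset.range (2 * n + 1), (2 * m).choose i := by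
    intro n
    induction n with
    | zero => simp
    | succ n ih =>
      rw [Finset.sum_range_succ, ih, show 2 * (n + 1) = 2 * n + 1 + 1 by ring,
        Finset.sum_range_succ _ (2 * n + 1 + 1), Finset.sum_range_succ _ (2 * n + 1),
        Nat.choose_succ_succ]
      ring
  have h' := h m
  rw [Nat.sum_range_choose, pow_mul] at h'
  exact_mod_cast h'

/-- Only the terms with $j+k=m$ reach degree $m$. There the product of powers is monic and the
central binomial factor is constant, so the sum is $4^m\binom{2m}{m}/8^m$. -/
theorem borosMollCoeff_self (m : ℕ) :
    borosMollCoeff m m = ((2 * m).choose m : ℝ) / 2 ^ m := by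
  have key : ∀ j ∈ Finset.range (m + 1), ∀ k ∈ Finset.range (m + 1),
      (C (borosMollTerm m j k) * ((X + 1) ^ j * (X - 1) ^ k)).coeff m =
        if k = m - j then borosMollTerm m j k else 0 := by
    intro j hj k hk
    simp only [Finset.mem_range] at hj hk
    rw [coeff_C_mul]
    have h1 := monic_X_add_C (1 : ℝ) |>.pow j
    have h2 := monic_X_add_C (-1 : ℝ) |>.pow k
    have h3 := h1.mul h2
    have h4 := h1.natDegree_mul h2
    rw [natDegree_pow_X_add_C, natDegree_pow_X_add_C] at h4
    simp only [map_one, map_neg, ← sub_eq_add_neg] at h3 h4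
    rcases lt_trichotomy k (m - j) with h | h | h
    · rw [if_neg h.ne, coeff_eq_zero_of_natDegree_lt (by omega), mul_zero]
    · rw [if_pos h, show m = j + k by omega, ← h4, coeff_natDegree, h3.leadingCoeff, mul_one, h4]
    · rw [if_neg h.ne', borosMollTerm_of_lt_right h, zero_mul]
  unfold borosMollCoeff
  rw [borosMollPoly_eq, finsetSum_coeff]
  simp only [finsetSum_coeff]
  rw [Finset.sum_congr rfl fun j hj => Finset.sum_congr rfl fun k hk => key j hj k hk]
  have : ∀ j ∈ Finset.range (m + 1), (∑ k ∈ Finset.range (m + 1),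
      if k = m - j then borosMollTerm m j k else 0) =
      ((2 * m + 1).choose (2 * j) : ℝ) * (((2 * m).choose m : ℝ) / 8 ^ m) := by
    intro j hj
    simp only [Finset.mem_range] at hj
    rw [Finset.sum_ite_eq', if_pos (by simp), borosMollTerm, ← mul_add,
      Nat.sub_add_cancel (by omega), Nat.choose_self, pow_mul]
    norm_num
    ring
  rw [Finset.sum_congr rfl this, ← Finset.sum_mul, sum_choose_two_mul,
    show (8 : ℝ) = 4 * 2 by norm_num, mul_pow]
  field_simp

end

/-! ### Expansion in powers of $a+1$ -/

section
open Polynomial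

/-- The Boros-Moll polynomial in powers of `a + 1` satisfies a two-term recurrence. -/
theorem borosMollPoly_comp_coeff_recurrence (m n : ℕ) :
    ((n : ℝ) + 1) * (2 * m - 2 * n - 1) * ((borosMollPoly m).comp (X - 1)).coeff (n + 1) =
      (m - n) * (m + n + 1) * ((borosMollPoly m).comp (X - 1)).coeff n := by
  set Q := (borosMollPoly m).comp (X - 1) with hQ
  have hQ' : (derivative (borosMollPoly m)).comp (X - 1) = derivative Q := by
    simp [hQ, derivative_comp]
  have hQ'' : (derivative (derivative (borosMollPoly m))).comp (X - 1) =
      derivative (derivative Q) := by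
    rw [← hQ']
    simp [derivative_comp]
  have h := congrArg (fun P => P.comp (X - 1)) (borosMollPoly_ode m)
  simp only [add_comp, sub_comp, mul_comp, one_comp, pow_comp, X_comp, C_comp, ofNat_comp, zero_comp,
    hQ', hQ'', ← hQ, Nat.cast_ofNat] at h
  have h := congrArg (fun P => coeff P n) h
  have h1 : ∀ P : ℝ[X], (X * derivative P).coeff n = n * P.coeff n := by
    intro P
    rcases n with _ | n
    · simp
    · rw [coeff_X_mul, coeff_derivative]
      push_cast
      ring
  -- Since $1-(X-1)^2=2X-X^2$ has no constant term, only the coefficients of index $n$ and $n+1$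
  -- enter, and the recurrence has two terms.
  have e : (1 - (X - 1) ^ 2) * derivative (derivative Q) - C (2 * (m : ℝ) + 1) * derivative Q
      - 2 * (X - 1) * derivative Q + C ((m : ℝ) * (m + 1)) * Q =
      C 2 * (X * derivative (derivative Q)) + X * derivative Q - X * derivative (X * derivative Q)
        - C (2 * (m : ℝ) - 1) * derivative Q - C 2 * (X * derivative Q)
        + C ((m : ℝ) * (m + 1)) * Q := by
    have e1 : derivative (X * derivative Q) = derivative Q + X * derivative (derivative Q) := by
      simp [derivative_mul]
    have e2 : C (2 * (m : ℝ) + 1) = C (2 * (m : ℝ) - 1) + 2 := by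
      rw [← map_ofNat C 2, ← map_add]
      ring_nf
    rw [e1, e2, map_ofNat]
    ring
  rw [e] at h
  simp only [coeff_add, coeff_sub, coeff_C_mul, h1, coeff_derivative, coeff_zero] at h
  linear_combination -h

theorem borosMollPoly_comp_coeff_self (m : ℕ) :
    ((borosMollPoly m).comp (X - 1)).coeff m = borosMollCoeff m m := by
  have hn : (borosMollPoly m).natDegree ≤ m :=
    natDegree_le_iff_coeff_eq_zero.mpr fun i hi => borosMollCoeff_of_lt hi
  have hd : 0 < borosMollCoeff m m := by
    rw [borosMollCoeff_self]
    have := Nat.choose_pos (show m ≤ 2 * m by omega)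
    positivity
  have hm : (borosMollPoly m).natDegree = m := by
    refine le_antisymm hn (le_natDegree_of_ne_zero hd.ne')
  have h1 : (X - 1 : ℝ[X]).natDegree = 1 := by
    simpa using natDegree_X_sub_C (1 : ℝ)
  have h2 : (X - 1 : ℝ[X]).leadingCoeff = 1 := by
    simpa using leadingCoeff_X_sub_C (1 : ℝ)
  have h3 := coeff_comp_degree_mul_degree (p := borosMollPoly m) (q := X - 1) (by rw [h1]; simp)
  rw [h1, h2, hm, mul_one, one_pow, mul_one] at h3
  rw [h3, leadingCoeff, hm, borosMollCoeff]

theorem borosMollCoeff_self_pos (m : ℕ) : 0 < borosMollCoeff m m := by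
  rw [borosMollCoeff_self]
  have := Nat.choose_pos (show m ≤ 2 * m by omega)
  positivity

/-- Below the top index both factors of the two-term recurrence are positive, so the sign of the
leading coefficient propagates downwards. -/
theorem borosMollPoly_comp_coeff_nonneg {m i : ℕ} (h : i ≤ m) :
    0 ≤ ((borosMollPoly m).comp (X - 1)).coeff i := by
  induction h using Nat.decreasingInduction with
  | self =>
    rw [borosMollPoly_comp_coeff_self]
    exact (borosMollCoeff_self_pos m).le
  | of_succ n hn ih =>
    have h := borosMollPoly_comp_coeff_recurrence m n
    have hn' : (n : ℝ) + 1 ≤ m := by exact_mod_cast hn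
    have h1 : (0 : ℝ) < (m - n) * (m + n + 1) := mul_pos (by linarith) (by positivity)
    refine nonneg_of_mul_nonneg_right (a := ((m : ℝ) - n) * (m + n + 1)) ?_ h1
    rw [← h]
    exact mul_nonneg (mul_nonneg (by positivity) (by linarith)) ih

/-- The constant coefficient is at least `3 / 2` times the leading one. -/
theorem three_mul_borosMollCoeff_self_le {m : ℕ} (hm : 1 ≤ m) :
    3 * borosMollCoeff m m ≤ 2 * borosMollCoeff m 0 := by
  obtain ⟨n, rfl⟩ : ∃ n, m = n + 1 := ⟨m - 1, by omega⟩
  set Q := (borosMollPoly (n + 1)).comp (X - 1) with hQ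
  have hdeg : Q.natDegree < n + 2 := by
    refine lt_of_le_of_lt natDegree_comp_le ?_
    have h1 : (X - 1 : ℝ[X]).natDegree = 1 := by
      simpa using natDegree_X_sub_C (1 : ℝ)
    have hn : (borosMollPoly (n + 1)).natDegree ≤ n + 1 :=
      natDegree_le_iff_coeff_eq_zero.mpr fun i hi => borosMollCoeff_of_lt hi
    rw [h1]
    omega
  have h0 : borosMollCoeff (n + 1) 0 = ∑ k ∈ Finset.range (n + 2), Q.coeff k := by
    rw [borosMollCoeff, coeff_zero_eq_eval_zero]
    have h2 : Q.eval 1 = (borosMollPoly (n + 1)).eval 0 := by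
      simp [hQ, eval_comp]
    rw [← h2, eval_eq_sum_range' hdeg]
    simp
  have h1 := borosMollPoly_comp_coeff_recurrence (n + 1) n
  have h2 := borosMollPoly_comp_coeff_self (n + 1)
  rw [← hQ] at h1 h2
  have h3 : 0 ≤ ∑ k ∈ Finset.range n, Q.coeff k :=
    Finset.sum_nonneg fun k hk => borosMollPoly_comp_coeff_nonneg
      (by have := Finset.mem_range.mp hk; omega)
  rw [Finset.sum_range_succ, Finset.sum_range_succ, h2] at h0
  rw [h2] at h1
  push_cast at h1
  -- The value at $0$ is the sum of the coefficients in powers of $a+1$. The last two are $d_m$ and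
  -- $d_m/2$, which gives the factor $3/2$.
  have h4 : borosMollCoeff (n + 1) (n + 1) = 2 * Q.coeff n := by
    have : ((n : ℝ) + 1) ≠ 0 := by positivity
    apply mul_left_cancel₀ this
    linear_combination h1
  linarith

end

/-! ### The quartic form and its coefficients -/

/-- A quartic form on a quadrant is nonnegative when its Bernstein coefficients are; here the form
is `E i (i + 1) A² - (i - 1) B C` for three quadratic forms `A`, `B`, `C`. -/
theorem quartic_nonneg_of_coeff_nonneg {i D E al0 A1 al2 be0 B1 B2 ga0 ga1 ga2 r s : ℝ}
    (hi : 0 ≤ i) (hD : 0 ≤ D) (hr : 0 ≤ r) (hs : 0 ≤ s)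
    (k0 : 0 ≤ E * (i + 1) * al0 ^ 2 - (i - 1) * (be0 * ga0))
    (k1 : 0 ≤ 2 * E * (i + 1) * (al0 * A1) - (i - 1) * (be0 * (D * ga1) + B1 * ga0))
    (k2 : 0 ≤ E * (i + 1) * (A1 ^ 2 + 2 * i * D * (al0 * al2)) - (i - 1) * (be0 * (D ^ 2 * ga2) +
      B1 * (D * ga1) + i * (B2 * ga0)))
    (k3 : 0 ≤ 2 * E * i * (i + 1) * (A1 * al2) - (i - 1) * (B1 * (D * ga2) + i * (B2 * ga1)))
    (k4 : 0 ≤ E * i * (i + 1) * al2 ^ 2 - (i - 1) * (B2 * ga2)) :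
    0 ≤ E * i * (i + 1) * (i * al0 * s ^ 2 + A1 * (r * s) + D * al2 * r ^ 2) ^ 2
      - (i - 1) * ((i * be0 * s ^ 2 + B1 * (r * s) + B2 * r ^ 2)
        * (i ^ 2 * ga0 * s ^ 2 + i * D * ga1 * (r * s) + D ^ 2 * ga2 * r ^ 2)) := by
  -- The placeholders are the five quantities of `k0` to `k4`. The powers of $i$ and $D$ in front
  -- are common factors taken out of the coefficients of the form.
  have h : 0 ≤ i ^ 3 * s ^ 4 * _ + i ^ 2 * (s ^ 3 * r) * _ + i * (s ^ 2 * r ^ 2) * _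
      + D * (s * r ^ 3) * _ + D ^ 2 * r ^ 4 * _ :=
    add_nonneg (add_nonneg (add_nonneg (add_nonneg
      (mul_nonneg (by positivity) k0) (mul_nonneg (by positivity) k1))
      (mul_nonneg (by positivity) k2)) (mul_nonneg (by positivity) k3))
      (mul_nonneg (by positivity) k4)
  refine h.trans_eq ?_
  ring

/-- This and the next four bounds are the hypotheses `k0` to `k4` for $i=a+2$, $D=b+2$,
$E=(b+3)(2a+b+4)$. In the first four, the negative monomials of the expansion are absorbed as cross
terms of weighted squares. In the last, every coefficient is nonnegative. -/
theorem moll_bernstein_zero {a b : ℝ} (ha : 0 ≤ a) (hb : 0 ≤ b) :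
    0 ≤ ((b + 3) * (2 * a + b + 4)) * ((a + 2) + 1) * (-3 * a ^ 3 + 4 * a * b - 11 * a ^ 2 + 4 *
      b ^ 2 - 4 * a + 16 * b + 16) ^ 2 - ((a + 2) - 1) * ((-3 * a ^ 3 + 8 * a * b - a ^ 2 + 4 * b
      ^ 2 + 34 * a + 28 * b + 56) * (-3 * a ^ 3 * b ^ 2 - 6 * a ^ 4 * b + 8 * a * b ^ 3 - 11 * a
      ^ 2 * b ^ 2 - 51 * a ^ 3 * b - 10 * a ^ 4 + 4 * b ^ 4 + 2 * a * b ^ 2 - 153 * a ^ 2 * b -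
      88 * a ^ 3 + 32 * b ^ 3 - 190 * a * b - 265 * a ^ 2 + 48 * b ^ 2 - 324 * a - 64 * b - 128))
      := by
  have h : 0 ≤
      30 * b ^ 2 * (b ^ 2 - 6/5 * a ^ 3) ^ 2 + 320/3 * a * b * (b ^ 2 - 3/4 * a ^ 3) ^ 2 + 318 *
        b * (b ^ 2 - 4/3 * a ^ 3) ^ 2 + 256 * a * b * (b - a ^ 2) ^ 2 + 24/5 * a ^ 6 * b ^ 2 + 12
        * a ^ 7 * b + 24 * a ^ 8 + 244 * a ^ 5 * b ^ 2 + 728/3 * a ^ 6 * b + 362 * a ^ 7 + 64/3 *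
        a * b ^ 5 + 8 * a ^ 2 * b ^ 4 + 16 * a ^ 4 * b ^ 2 + 3280 * a ^ 5 * b + 2357 * a ^ 6 + 2
        * b ^ 6 + 1552 * a * b ^ 4 + 528 * a ^ 2 * b ^ 3 + 8172 * a ^ 4 * b + 8450 * a ^ 5 + 162
        * b ^ 5 + 8160 * a * b ^ 3 + 7260 * a ^ 2 * b ^ 2 + 14300 * a ^ 3 * b + 18509 * a ^ 4 +
        3104 * b ^ 4 + 26504 * a * b ^ 2 + 28928 * a ^ 2 * b + 27822 * a ^ 3 + 11328 * b ^ 3 +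
        46080 * a * b + 33824 * a ^ 2 + 24960 * b ^ 2 + 32736 * a + 30976 * b + 16384 := by
    positivity
  exact h.trans_eq (by ring)

theorem moll_bernstein_one {a b : ℝ} (ha : 0 ≤ a) (hb : 0 ≤ b) :
    0 ≤ 2 * ((b + 3) * (2 * a + b + 4)) * ((a + 2) + 1) * ((-3 * a ^ 3 + 4 * a * b - 11 * a ^ 2 +
      4 * b ^ 2 - 4 * a + 16 * b + 16) * (-4 * a ^ 4 + 8 * a * b ^ 2 + 6 * a ^ 2 * b - 24 * a ^ 3
      + 50 * a * b - 35 * a ^ 2 + 16 * b ^ 2 + 38 * a + 76 * b + 88)) - ((a + 2) - 1) * ((-3 * a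
      ^ 3 + 8 * a * b - a ^ 2 + 4 * b ^ 2 + 34 * a + 28 * b + 56) * ((b + 2) * (-4 * a ^ 4 * b -
      8 * a ^ 5 + 8 * a * b ^ 3 + 10 * a ^ 2 * b ^ 2 - 32 * a ^ 3 * b - 84 * a ^ 4 + 64 * a * b ^
      2 - 89 * a ^ 2 * b - 338 * a ^ 3 + 12 * b ^ 3 - 63 * a * b - 649 * a ^ 2 + 78 * b ^ 2 - 567
      * a + 30 * b - 156)) + (-4 * a ^ 4 + 8 * a * b ^ 2 + 18 * a ^ 2 * b - 4 * a ^ 3 + 104 * a *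
      b + 93 * a ^ 2 + 20 * b ^ 2 + 313 * a + 146 * b + 292) * (-3 * a ^ 3 * b ^ 2 - 6 * a ^ 4 *
      b + 8 * a * b ^ 3 - 11 * a ^ 2 * b ^ 2 - 51 * a ^ 3 * b - 10 * a ^ 4 + 4 * b ^ 4 + 2 * a *
      b ^ 2 - 153 * a ^ 2 * b - 88 * a ^ 3 + 32 * b ^ 3 - 190 * a * b - 265 * a ^ 2 + 48 * b ^ 2
      - 324 * a - 64 * b - 128)) := by
  have h : 0 ≤
      120 * a * b ^ 2 * (b ^ 2 - a ^ 3) ^ 2 + 312 * a ^ 2 * b * (b ^ 2 - 2/3 * a ^ 3) ^ 2 + 3072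
        * a ^ 2 * b ^ 2 * (b - 1/2 * a ^ 2) ^ 2 + 104 * b ^ 2 * (b ^ 2 - 3/2 * a ^ 3) ^ 2 + 40 *
        a ^ 7 * b ^ 2 + 232/3 * a ^ 8 * b + 56 * a ^ 9 + 398 * a ^ 6 * b ^ 2 + 3164 * a ^ 7 * b +
        1112 * a ^ 8 + 8 * a * b ^ 6 + 184 * a ^ 2 * b ^ 5 + 4200 * a ^ 5 * b ^ 2 + 18924 * a ^ 6
        * b + 9398 * a ^ 7 + 3040 * a * b ^ 5 + 3904 * a ^ 2 * b ^ 4 + 56 * a ^ 3 * b ^ 3 + 8544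
        * a ^ 4 * b ^ 2 + 62118 * a ^ 5 * b + 43950 * a ^ 6 + 152 * b ^ 6 + 27320 * a * b ^ 4 +
        47896 * a ^ 2 * b ^ 3 + 49228 * a ^ 3 * b ^ 2 + 136854 * a ^ 4 * b + 126777 * a ^ 5 +
        4080 * b ^ 5 + 131256 * a * b ^ 3 + 205544 * a ^ 2 * b ^ 2 + 264950 * a ^ 3 * b + 245268
        * a ^ 4 + 28000 * b ^ 4 + 370652 * a * b ^ 2 + 475950 * a ^ 2 * b + 355407 * a ^ 3 +
        107064 * b ^ 3 + 573568 * a * b + 421708 * a ^ 2 + 241392 * b ^ 2 + 366544 * a + 299552 *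
        b + 156224 := by
    positivity
  exact h.trans_eq (by ring)

theorem moll_bernstein_two {a b : ℝ} (ha : 0 ≤ a) (hb : 0 ≤ b) :
    0 ≤ ((b + 3) * (2 * a + b + 4)) * ((a + 2) + 1) * ((-4 * a ^ 4 + 8 * a * b ^ 2 + 6 * a ^ 2 *
      b - 24 * a ^ 3 + 50 * a * b - 35 * a ^ 2 + 16 * b ^ 2 + 38 * a + 76 * b + 88) ^ 2 + 2 * (a
      + 2) * (b + 2) * ((-3 * a ^ 3 + 4 * a * b - 11 * a ^ 2 + 4 * b ^ 2 - 4 * a + 16 * b + 16) *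
      (4 * a * b + 4 * a ^ 2 + 24 * a + 9 * b + 33))) - ((a + 2) - 1) * ((-3 * a ^ 3 + 8 * a * b
      - a ^ 2 + 4 * b ^ 2 + 34 * a + 28 * b + 56) * ((b + 2) ^ 2 * (4 * a ^ 2 * b ^ 2 + 4 * a ^ 3
      * b + 13 * a * b ^ 2 + 38 * a ^ 2 * b + 4 * a ^ 3 + 100 * a * b + 34 * a ^ 2 + 12 * b ^ 2 +
      87 * a + 84 * b + 72)) + (-4 * a ^ 4 + 8 * a * b ^ 2 + 18 * a ^ 2 * b - 4 * a ^ 3 + 104 * a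
      * b + 93 * a ^ 2 + 20 * b ^ 2 + 313 * a + 146 * b + 292) * ((b + 2) * (-4 * a ^ 4 * b - 8 *
      a ^ 5 + 8 * a * b ^ 3 + 10 * a ^ 2 * b ^ 2 - 32 * a ^ 3 * b - 84 * a ^ 4 + 64 * a * b ^ 2 -
      89 * a ^ 2 * b - 338 * a ^ 3 + 12 * b ^ 3 - 63 * a * b - 649 * a ^ 2 + 78 * b ^ 2 - 567 * a
      + 30 * b - 156)) + (a + 2) * ((4 * a * b ^ 2 + 12 * a ^ 2 * b + 8 * a ^ 3 + 64 * a * b + 72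
      * a ^ 2 + 13 * b ^ 2 + 202 * a + 97 * b + 192) * (-3 * a ^ 3 * b ^ 2 - 6 * a ^ 4 * b + 8 *
      a * b ^ 3 - 11 * a ^ 2 * b ^ 2 - 51 * a ^ 3 * b - 10 * a ^ 4 + 4 * b ^ 4 + 2 * a * b ^ 2 -
      153 * a ^ 2 * b - 88 * a ^ 3 + 32 * b ^ 3 - 190 * a * b - 265 * a ^ 2 + 48 * b ^ 2 - 324 *
      a - 64 * b - 128))) := by
  have h : 0 ≤
      132 * a ^ 2 * b ^ 2 * (b ^ 2 - a ^ 3) ^ 2 + 320 * a ^ 3 * b * (b ^ 2 - 1/2 * a ^ 3) ^ 2 +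
        2808 * a ^ 3 * b ^ 2 * (b - 1/2 * a ^ 2) ^ 2 + 144 * a * b ^ 2 * (b ^ 2 - 3/2 * a ^ 3) ^
        2 + 44 * a ^ 8 * b ^ 2 + 128 * a ^ 9 * b + 32 * a ^ 10 + 1134 * a ^ 7 * b ^ 2 + 3776 * a
        ^ 8 * b + 912 * a ^ 9 + 60 * a ^ 2 * b ^ 6 + 448 * a ^ 3 * b ^ 5 + 11020 * a ^ 6 * b ^ 2
        + 28676 * a ^ 7 * b + 10224 * a ^ 8 + 648 * a * b ^ 6 + 6416 * a ^ 2 * b ^ 5 + 9790 * a ^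
        3 * b ^ 4 + 3808 * a ^ 4 * b ^ 3 + 37390 * a ^ 5 * b ^ 2 + 122556 * a ^ 6 * b + 61852 * a
        ^ 7 + 16584 * a * b ^ 5 + 71430 * a ^ 2 * b ^ 4 + 106656 * a ^ 3 * b ^ 3 + 147227 * a ^ 4
        * b ^ 2 + 346794 * a ^ 5 * b + 230334 * a ^ 6 + 808 * b ^ 6 + 142196 * a * b ^ 4 + 412816
        * a ^ 2 * b ^ 3 + 571110 * a ^ 3 * b ^ 2 + 778153 * a ^ 4 * b + 574854 * a ^ 5 + 13608 *
        b ^ 5 + 657084 * a * b ^ 3 + 1387711 * a ^ 2 * b ^ 2 + 1564956 * a ^ 3 * b + 1051416 * a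
        ^ 4 + 97868 * b ^ 4 + 1746760 * a * b ^ 2 + 2512343 * a ^ 2 * b + 1546638 * a ^ 3 +
        385892 * b ^ 3 + 2499128 * a * b + 1832214 * a ^ 2 + 878712 * b ^ 2 + 1472752 * a +
        1082416 * b + 554976 := by
    positivity
  exact h.trans_eq (by ring)

theorem moll_bernstein_three {a b : ℝ} (ha : 0 ≤ a) (hb : 0 ≤ b) :
    0 ≤ 2 * ((b + 3) * (2 * a + b + 4)) * (a + 2) * ((a + 2) + 1) * ((-4 * a ^ 4 + 8 * a * b ^ 2
      + 6 * a ^ 2 * b - 24 * a ^ 3 + 50 * a * b - 35 * a ^ 2 + 16 * b ^ 2 + 38 * a + 76 * b + 88)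
      * (4 * a * b + 4 * a ^ 2 + 24 * a + 9 * b + 33)) - ((a + 2) - 1) * ((-4 * a ^ 4 + 8 * a * b
      ^ 2 + 18 * a ^ 2 * b - 4 * a ^ 3 + 104 * a * b + 93 * a ^ 2 + 20 * b ^ 2 + 313 * a + 146 *
      b + 292) * ((b + 2) * (4 * a ^ 2 * b ^ 2 + 4 * a ^ 3 * b + 13 * a * b ^ 2 + 38 * a ^ 2 * b
      + 4 * a ^ 3 + 100 * a * b + 34 * a ^ 2 + 12 * b ^ 2 + 87 * a + 84 * b + 72)) + (a + 2) *
      ((4 * a * b ^ 2 + 12 * a ^ 2 * b + 8 * a ^ 3 + 64 * a * b + 72 * a ^ 2 + 13 * b ^ 2 + 202 *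
      a + 97 * b + 192) * (-4 * a ^ 4 * b - 8 * a ^ 5 + 8 * a * b ^ 3 + 10 * a ^ 2 * b ^ 2 - 32 *
      a ^ 3 * b - 84 * a ^ 4 + 64 * a * b ^ 2 - 89 * a ^ 2 * b - 338 * a ^ 3 + 12 * b ^ 3 - 63 *
      a * b - 649 * a ^ 2 + 78 * b ^ 2 - 567 * a + 30 * b - 156))) := by
  have h : 0 ≤
      72 * a ^ 3 * b * (b ^ 2 - 2/3 * a ^ 3) ^ 2 + 96 * a ^ 4 * (b ^ 2 - 1/3 * a ^ 3) ^ 2 + 184 *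
        a ^ 4 * b * (b - 1/2 * a ^ 2) ^ 2 + 32 * a ^ 9 * b + 160/3 * a ^ 10 + 946 * a ^ 8 * b +
        1248 * a ^ 9 + 56 * a ^ 3 * b ^ 5 + 464 * a ^ 4 * b ^ 4 + 128 * a ^ 5 * b ^ 3 + 6952 * a
        ^ 7 * b + 10624 * a ^ 8 + 816 * a ^ 2 * b ^ 5 + 5520 * a ^ 3 * b ^ 4 + 10224 * a ^ 4 * b
        ^ 3 + 8988 * a ^ 5 * b ^ 2 + 32320 * a ^ 6 * b + 52592 * a ^ 7 + 1704 * a * b ^ 5 + 19996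
        * a ^ 2 * b ^ 4 + 65960 * a ^ 3 * b ^ 3 + 90516 * a ^ 4 * b ^ 2 + 127834 * a ^ 5 * b +
        172868 * a ^ 6 + 31552 * a * b ^ 4 + 180158 * a ^ 2 * b ^ 3 + 375488 * a ^ 3 * b ^ 2 +
        440106 * a ^ 4 * b + 420326 * a ^ 5 + 1176 * b ^ 5 + 233330 * a * b ^ 3 + 802152 * a ^ 2
        * b ^ 2 + 1121942 * a ^ 3 * b + 832402 * a ^ 4 + 18372 * b ^ 4 + 873500 * a * b ^ 2 +
        1829140 * a ^ 2 * b + 1366094 * a ^ 3 + 117552 * b ^ 3 + 1669258 * a * b + 1674142 * a ^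
        2 + 385404 * b ^ 2 + 1274952 * a + 646776 * b + 436032 := by
    positivity
  exact h.trans_eq (by ring)

theorem moll_bernstein_four {a b : ℝ} (ha : 0 ≤ a) (hb : 0 ≤ b) :
    0 ≤ ((b + 3) * (2 * a + b + 4)) * (a + 2) * ((a + 2) + 1) * (4 * a * b + 4 * a ^ 2 + 24 * a +
      9 * b + 33) ^ 2 - ((a + 2) - 1) * ((4 * a * b ^ 2 + 12 * a ^ 2 * b + 8 * a ^ 3 + 64 * a * b
      + 72 * a ^ 2 + 13 * b ^ 2 + 202 * a + 97 * b + 192) * (4 * a ^ 2 * b ^ 2 + 4 * a ^ 3 * b +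
      13 * a * b ^ 2 + 38 * a ^ 2 * b + 4 * a ^ 3 + 100 * a * b + 34 * a ^ 2 + 12 * b ^ 2 + 87 *
      a + 84 * b + 72)) := by
  have h : 0 ≤
      32 * a ^ 3 * b ^ 4 + 160 * a ^ 4 * b ^ 3 + 240 * a ^ 5 * b ^ 2 + 176 * a ^ 6 * b + 64 * a ^
        7 + 216 * a ^ 2 * b ^ 4 + 1472 * a ^ 3 * b ^ 3 + 3216 * a ^ 4 * b ^ 2 + 2976 * a ^ 5 * b
        + 1232 * a ^ 6 + 464 * a * b ^ 4 + 5168 * a ^ 2 * b ^ 3 + 16564 * a ^ 3 * b ^ 2 + 20548 *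
        a ^ 4 * b + 10128 * a ^ 5 + 8056 * a * b ^ 3 + 41856 * a ^ 2 * b ^ 2 + 73896 * a ^ 3 * b
        + 45940 * a ^ 4 + 330 * b ^ 4 + 52256 * a * b ^ 2 + 146524 * a ^ 2 * b + 123764 * a ^ 3 +
        4710 * b ^ 3 + 152520 * a * b + 197748 * a ^ 2 + 25926 * b ^ 2 + 173520 * a + 65394 * b +
        64584 := by
    positivity
  exact h.trans_eq (by ring)

/-- The log-concavity of the Moll sequence as the nonnegativity of a quartic form on a cone. The
arguments `x` and `y` stand for `d_i(m)` and `d_{i-1}(m)`, with `i = a + 2` and `m = a + b + 3`. -/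
theorem moll_quartic_nonneg {m i x y : ℝ} (hi : 2 ≤ i) (him : i + 1 ≤ m)
    (hl : 2 * i * x ≤ (2 * m - i) * y) (hu : 2 * (m - i + 1) * y ≤ (2 * i + 1) * x) :
    (i - 1) * (((m - i + 2) * (m + i - 1) * y ^ 2 - (2 * m + 1) * (i - 1) * (x * y)
        + i * (i - 1) * x ^ 2)
      * ((i + 2) * ((2 * m + 1) * i * x - (m - i + 1) * (m + i) * y) ^ 2
        - (2 * m + 1) * i * (i + 1) * (((2 * m + 1) * i * x - (m - i + 1) * (m + i) * y) * x)
        + (m - i) * (m + i + 1) * i ^ 2 * (i + 1) * x ^ 2)) ≤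
    (m - i + 2) * (m + i - 1) * i * (i + 1)
      * ((m - i + 1) * (m + i) * y ^ 2 - (2 * m + 1) * i * (x * y) + i * (i + 1) * x ^ 2) ^ 2 := by
  obtain ⟨a, rfl⟩ : ∃ a, i = a + 2 := ⟨i - 2, by ring⟩
  obtain ⟨b, rfl⟩ : ∃ b, m = a + b + 3 := ⟨m - a - 3, by ring⟩
  have ha : 0 ≤ a := by linarith
  have hb : 0 ≤ b := by linarith
  -- The coordinates $r,s\ge0$ are the slacks of the two ratio bounds.
  have hr : 0 ≤ (a + 2 * b + 4) * y - 2 * (a + 2) * x := by linear_combination hl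
  have hs : 0 ≤ (2 * a + 5) * x - 2 * (b + 2) * y := by linear_combination hu
  -- Up to sign, this is the determinant of the change of variables from $(x,y)$ to $(r,s)$. Its
  -- square is the factor by which each quadratic form is multiplied when written in $r,s$.
  have hV : 0 < 2 * a ^ 2 + 5 * a + 2 * b + 4 := by positivity
  have key := quartic_nonneg_of_coeff_nonneg (by positivity : 0 ≤ a + 2)
    (by positivity : 0 ≤ b + 2) hr hs (moll_bernstein_zero ha hb) (moll_bernstein_one ha hb)
    (moll_bernstein_two ha hb) (moll_bernstein_three ha hb) (moll_bernstein_four ha hb)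
  have hA :
      (a + 2) * (-3 * a ^ 3 + 4 * a * b - 11 * a ^ 2 + 4 * b ^ 2 - 4 * a + 16 * b + 16) * ((2 * a
        + 5) * x - 2 * (b + 2) * y) ^ 2 + (-4 * a ^ 4 + 8 * a * b ^ 2 + 6 * a ^ 2 * b - 24 * a ^
        3 + 50 * a * b - 35 * a ^ 2 + 16 * b ^ 2 + 38 * a + 76 * b + 88) * (((a + 2 * b + 4) * y
        - 2 * (a + 2) * x) * ((2 * a + 5) * x - 2 * (b + 2) * y)) + (b + 2) * (4 * a * b + 4 * a
        ^ 2 + 24 * a + 9 * b + 33) * ((a + 2 * b + 4) * y - 2 * (a + 2) * x) ^ 2 =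
      (2 * a ^ 2 + 5 * a + 2 * b + 4) ^ 2 * (((a + b + 3) - (a + 2) + 1) * ((a + b + 3) + (a +
        2)) * y ^ 2 - (2 * (a + b + 3) + 1) * (a + 2) * (x * y) + (a + 2) * ((a + 2) + 1) * x ^
        2) := by
    ring
  have hB :
      (a + 2) * (-3 * a ^ 3 + 8 * a * b - a ^ 2 + 4 * b ^ 2 + 34 * a + 28 * b + 56) * ((2 * a +
        5) * x - 2 * (b + 2) * y) ^ 2 + (-4 * a ^ 4 + 8 * a * b ^ 2 + 18 * a ^ 2 * b - 4 * a ^ 3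
        + 104 * a * b + 93 * a ^ 2 + 20 * b ^ 2 + 313 * a + 146 * b + 292) * (((a + 2 * b + 4) *
        y - 2 * (a + 2) * x) * ((2 * a + 5) * x - 2 * (b + 2) * y)) + (4 * a * b ^ 2 + 12 * a ^ 2
        * b + 8 * a ^ 3 + 64 * a * b + 72 * a ^ 2 + 13 * b ^ 2 + 202 * a + 97 * b + 192) * ((a +
        2 * b + 4) * y - 2 * (a + 2) * x) ^ 2 =
      (2 * a ^ 2 + 5 * a + 2 * b + 4) ^ 2 * (((a + b + 3) - (a + 2) + 2) * ((a + b + 3) + (a + 2)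
        - 1) * y ^ 2 - (2 * (a + b + 3) + 1) * ((a + 2) - 1) * (x * y) + (a + 2) * ((a + 2) - 1)
        * x ^ 2) := by
    ring
  have hC :
      (a + 2) ^ 2 * (-3 * a ^ 3 * b ^ 2 - 6 * a ^ 4 * b + 8 * a * b ^ 3 - 11 * a ^ 2 * b ^ 2 - 51
        * a ^ 3 * b - 10 * a ^ 4 + 4 * b ^ 4 + 2 * a * b ^ 2 - 153 * a ^ 2 * b - 88 * a ^ 3 + 32
        * b ^ 3 - 190 * a * b - 265 * a ^ 2 + 48 * b ^ 2 - 324 * a - 64 * b - 128) * ((2 * a + 5)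
        * x - 2 * (b + 2) * y) ^ 2 + (a + 2) * (b + 2) * (-4 * a ^ 4 * b - 8 * a ^ 5 + 8 * a * b
        ^ 3 + 10 * a ^ 2 * b ^ 2 - 32 * a ^ 3 * b - 84 * a ^ 4 + 64 * a * b ^ 2 - 89 * a ^ 2 * b
        - 338 * a ^ 3 + 12 * b ^ 3 - 63 * a * b - 649 * a ^ 2 + 78 * b ^ 2 - 567 * a + 30 * b -
        156) * (((a + 2 * b + 4) * y - 2 * (a + 2) * x) * ((2 * a + 5) * x - 2 * (b + 2) * y)) +
        (b + 2) ^ 2 * (4 * a ^ 2 * b ^ 2 + 4 * a ^ 3 * b + 13 * a * b ^ 2 + 38 * a ^ 2 * b + 4 *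
        a ^ 3 + 100 * a * b + 34 * a ^ 2 + 12 * b ^ 2 + 87 * a + 84 * b + 72) * ((a + 2 * b + 4)
        * y - 2 * (a + 2) * x) ^ 2 =
      (2 * a ^ 2 + 5 * a + 2 * b + 4) ^ 2 * (((a + 2) + 2) * ((2 * (a + b + 3) + 1) * (a + 2) * x
        - ((a + b + 3) - (a + 2) + 1) * ((a + b + 3) + (a + 2)) * y) ^ 2 - (2 * (a + b + 3) + 1)
        * (a + 2) * ((a + 2) + 1) * (((2 * (a + b + 3) + 1) * (a + 2) * x - ((a + b + 3) - (a +
        2) + 1) * ((a + b + 3) + (a + 2)) * y) * x) + ((a + b + 3) - (a + 2)) * ((a + b + 3) + (a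
        + 2) + 1) * (a + 2) ^ 2 * ((a + 2) + 1) * x ^ 2) := by
    ring
  rw [hA, hB, hC] at key
  have hE : (b + 3) * (2 * a + b + 4) =
      (a + b + 3 - (a + 2) + 2) * (a + b + 3 + (a + 2) - 1) := by
    ring
  have aux : ∀ E i V A B C : ℝ,
      E * i * (i + 1) * (V ^ 2 * A) ^ 2 - (i - 1) * ((V ^ 2 * B) * (V ^ 2 * C)) =
        V ^ 4 * (E * i * (i + 1) * A ^ 2 - (i - 1) * (B * C)) := by
    intros
    ring
  rw [hE, aux] at key
  exact sub_nonneg.mp (nonneg_of_mul_nonneg_right key (pow_pos hV 4))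

/-! ### Ratio bounds and strict log-concavity of the coefficients -/

theorem borosMollCoeff_recurrence (m : ℕ) {i : ℕ} (hi : 1 ≤ i) :
    (i : ℝ) * (i + 1) * borosMollCoeff m (i + 1) =
      (2 * m + 1) * i * borosMollCoeff m i
        - (m - i + 1) * (m + i) * borosMollCoeff m (i - 1) := by
  obtain ⟨n, rfl⟩ : ∃ n, i = n + 1 := ⟨i - 1, by omega⟩
  have h := borosMollCoeff_recurrence_shift m n
  rw [Nat.add_sub_cancel, show n + 1 + 1 = n + 2 by rfl]
  push_cast
  linear_combination h

/-- Two-sided bounds for the ratios `d_{i-1}(m) / d_i(m)`. -/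
theorem borosMollCoeff_ratio_bounds {m i : ℕ} (hm : 2 ≤ m) (hi : 1 ≤ i) (him : i ≤ m) :
    0 < borosMollCoeff m i ∧
      2 * i * borosMollCoeff m i ≤ (2 * m - i) * borosMollCoeff m (i - 1) ∧
      2 * (m - i + 1) * borosMollCoeff m (i - 1) ≤ (2 * i + 1) * borosMollCoeff m i := by
  have hm' : (2 : ℝ) ≤ m := by exact_mod_cast hm
  induction him using Nat.decreasingInduction with
  | self =>
    have h := borosMollCoeff_recurrence m hi
    have hd := borosMollCoeff_self_pos m
    rw [borosMollCoeff_of_lt (Nat.lt_succ_self m)] at h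
    -- With $d_{m+1}=0$ the recurrence fixes the ratio at $i=m$. The upper bound is then an
    -- equality, and the lower one amounts to $2m\ge3$.
    have h' : 2 * borosMollCoeff m (m - 1) = (2 * m + 1) * borosMollCoeff m m := by
      apply mul_left_cancel₀ (show (m : ℝ) ≠ 0 by positivity)
      linear_combination h
    refine ⟨hd, ?_, ?_⟩
    · have h1 : 0 ≤ (m : ℝ) * ((2 * m - 3) * borosMollCoeff m m) :=
        mul_nonneg (by positivity) (mul_nonneg (by linarith) hd.le)
      linear_combination h1 / 2 - m / 2 * h'
    · linear_combination h'
  | of_succ n hn ih =>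
    obtain ⟨hx, hl, hu⟩ := ih (by omega)
    have h := borosMollCoeff_recurrence m hi
    rw [Nat.add_sub_cancel] at hl hu
    have hn1 : (1 : ℝ) ≤ n := by exact_mod_cast hi
    have hnm : (n : ℝ) + 1 ≤ m := by exact_mod_cast hn
    push_cast at hl hu
    generalize borosMollCoeff m (n + 1) = x at *
    generalize borosMollCoeff m n = y at *
    generalize borosMollCoeff m (n - 1) = z at *
    generalize (n : ℝ) = i at *
    generalize (m : ℝ) = M at *
    have hy : 0 < y := by
      refine pos_of_mul_pos_right (lt_of_lt_of_le ?_ hl) (by linarith)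
      exact mul_pos (by linarith) hx
    have hq : 0 < (M - i + 1) * (M + i) := mul_pos (by linarith) (by linarith)
    -- The recurrence makes $d_{n-1}/d_n$ decreasing in $d_{n+1}/d_n$, so each bound at $n$ comes
    -- from the bound of the same kind at $n+1$.
    refine ⟨hy, ?_, ?_⟩
    · refine le_of_mul_le_mul_left ?_ hq
      have h1 := mul_le_mul_of_nonneg_left hl (mul_nonneg (show 0 ≤ 2 * M - i by linarith)
        (show 0 ≤ i by linarith))
      have h2 : 0 ≤ i * y * (2 * (M - i) + 3 * i ^ 2 - 5 * i) := by
        refine mul_nonneg (by positivity) ?_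
        have h3 : 0 ≤ (i - 1) * (3 * i - 2) := mul_nonneg (by linarith) (by linarith)
        linear_combination h3 + 2 * hnm
      linear_combination h1 / 2 + h2 / 2 - (2 * M - i) * h
    · refine le_of_mul_le_mul_left ?_ (show 0 < (2 * i + 3) * (M + i) by positivity)
      have h1 := mul_le_mul_of_nonneg_left hu (show 0 ≤ 2 * i * (i + 1) by positivity)
      have h2 : 0 ≤ (M - i) * y := mul_nonneg (by linarith) hy.le
      linear_combination h1 + 3 * h2 + 2 * (2 * i + 3) * h

theorem borosMollCoeff_pos {m i : ℕ} (hm : 2 ≤ m) (him : i ≤ m) : 0 < borosMollCoeff m i := by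
  rcases i with _ | i
  · have h1 := three_mul_borosMollCoeff_self_le (show 1 ≤ m by omega)
    have h2 := borosMollCoeff_self_pos m
    linarith
  · exact (borosMollCoeff_ratio_bounds hm (by omega) him).1

/-- Strict log-concavity of the Boros-Moll coefficients. -/
theorem borosMollCoeff_mul_lt_sq {m i : ℕ} (hm : 2 ≤ m) (hi : 1 ≤ i) (him : i ≤ m) :
    borosMollCoeff m (i - 1) * borosMollCoeff m (i + 1) < borosMollCoeff m i ^ 2 := by
  induction him using Nat.decreasingInduction with
  | self =>
    rw [borosMollCoeff_of_lt (Nat.lt_succ_self m), mul_zero]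
    exact pow_pos (borosMollCoeff_self_pos m) 2
  | of_succ n hn ih =>
    have h0 := ih (by omega)
    obtain ⟨hx, hl, -⟩ := borosMollCoeff_ratio_bounds hm (show 1 ≤ n + 1 by omega) hn
    have hy := borosMollCoeff_pos hm (show n ≤ m by omega)
    have h1 := borosMollCoeff_recurrence m hi
    have h2 := borosMollCoeff_recurrence m (show 1 ≤ n + 1 by omega)
    rw [Nat.add_sub_cancel] at h0 h2 hl
    have hn1 : (1 : ℝ) ≤ n := by exact_mod_cast hi
    have hnm : (n : ℝ) + 1 ≤ m := by exact_mod_cast hn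
    push_cast at hl h2
    generalize borosMollCoeff m (n + 1 + 1) = w at *
    generalize borosMollCoeff m (n + 1) = x at *
    generalize borosMollCoeff m n = y at *
    generalize borosMollCoeff m (n - 1) = z at *
    generalize (n : ℝ) = i at *
    generalize (m : ℝ) = M at *
    -- Eliminating $z$ and $w$ by the recurrence reduces the claim at $n$ to the one at $n+1$ plus a
    -- quadratic form in $x,y$. This weakened ratio bound makes that form nonnegative.
    have hxy : (i + 1) * x ≤ M * y := by
      have : 0 ≤ (i + 1) * y := by positivity
      linear_combination hl / 2 + this / 2
    have hsq : (i + 1) ^ 2 * x ^ 2 ≤ M ^ 2 * y ^ 2 := by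
      have := pow_le_pow_left₀ (by positivity) hxy 2
      rwa [mul_pow, mul_pow] at this
    have hq : 0 < (M - i + 1) * (M + i) := mul_pos (by linarith) (by linarith)
    refine lt_of_mul_lt_mul_left ?_ (mul_nonneg hq.le (show 0 ≤ i + 1 by linarith))
    have h3 := mul_lt_mul_of_pos_left h0 (show 0 < i by linarith)
    have h4 : 0 ≤ (M + i + i ^ 2) * y ^ 2 :=
      mul_nonneg (by nlinarith) (sq_nonneg y)
    have h5 : 0 ≤ (i + 1) * x ^ 2 := mul_nonneg (by linarith) (sq_nonneg x)
    linear_combination (i + 1) * (i + 2) * h3 + hsq + h4 + h5 + (i + 1) * x * h1 - i * y * h2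

/-! ### The Moll sequence -/

theorem mollSeq_pos {m i : ℕ} (hm : 2 ≤ m) (hi : 1 ≤ i) (him : i ≤ m) : 0 < mollSeq m i := by
  have h := borosMollCoeff_mul_lt_sq hm hi him
  exact mul_pos (by positivity) (sub_pos.mpr h)

theorem mollSeq_self (m : ℕ) :
    mollSeq m m = (m : ℝ) * ((m : ℝ) + 1) * ((2 * m).choose m : ℝ) ^ 2 / 2 ^ (2 * m) := by
  rw [mollSeq, borosMollCoeff_of_lt (Nat.lt_succ_self m), borosMollCoeff_self, mul_zero, sub_zero,
    div_pow, ← pow_mul, mul_comm m 2, mul_div_assoc]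

theorem mollSeq_mul_le_sq {m i : ℕ} (hi : 2 ≤ i) (him : i + 1 ≤ m) :
    mollSeq m (i - 1) * mollSeq m (i + 1) ≤ mollSeq m i ^ 2 := by
  have hm : 2 ≤ m := by omega
  obtain ⟨-, hl, hu⟩ := borosMollCoeff_ratio_bounds hm (show 1 ≤ i by omega) (show i ≤ m by omega)
  have hi' : (2 : ℝ) ≤ i := by exact_mod_cast hi
  have him' : (i : ℝ) + 1 ≤ m := by exact_mod_cast him
  have key := moll_quartic_nonneg hi' him' hl hu
  have r0 := borosMollCoeff_recurrence m (show 1 ≤ i - 1 by omega)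
  have r1 := borosMollCoeff_recurrence m (show 1 ≤ i by omega)
  have r2 := borosMollCoeff_recurrence m (show 1 ≤ i + 1 by omega)
  unfold mollSeq
  rw [Nat.sub_add_cancel (by omega : 1 ≤ i)] at r0 ⊢
  rw [Nat.add_sub_cancel] at r2 ⊢
  push_cast [Nat.cast_sub (show 1 ≤ i by omega)] at r0 r1 r2 ⊢
  generalize borosMollCoeff m (i - 1 - 1) = u at *
  generalize borosMollCoeff m (i - 1) = y at *
  generalize borosMollCoeff m i = x at *
  generalize borosMollCoeff m (i + 1 + 1) = w at *
  generalize borosMollCoeff m (i + 1) = z at *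
  generalize (i : ℝ) = I at *
  generalize (m : ℝ) = M at *
  -- The recurrence identifies the three quadratic forms with multiples of the factors
  -- $d_k^2-d_{k-1}d_{k+1}$ for $k=i$, $i-1$, $i+1$.
  have hA : (M - I + 1) * (M + I) * y ^ 2 - (2 * M + 1) * I * (x * y) + I * (I + 1) * x ^ 2 =
      I * (I + 1) * (x ^ 2 - y * z) := by
    linear_combination y * r1
  have hB : (M - I + 2) * (M + I - 1) * y ^ 2 - (2 * M + 1) * (I - 1) * (x * y)
        + I * (I - 1) * x ^ 2 =
      (M - I + 2) * (M + I - 1) * (y ^ 2 - u * x) := by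
    linear_combination x * r0
  have hC : (I + 2) * ((2 * M + 1) * I * x - (M - I + 1) * (M + I) * y) ^ 2
        - (2 * M + 1) * I * (I + 1) * (((2 * M + 1) * I * x - (M - I + 1) * (M + I) * y) * x)
        + (M - I) * (M + I + 1) * I ^ 2 * (I + 1) * x ^ 2 =
      I ^ 2 * (I + 1) ^ 2 * (I + 2) * (z ^ 2 - x * w) := by
    rw [← r1]
    linear_combination I ^ 2 * (I + 1) * x * r2
  rw [hA, hB, hC] at key
  have hpos : 0 < (M - I + 2) * (M + I - 1) * (I * (I + 1)) :=
    mul_pos (mul_pos (by linarith) (by linarith)) (by positivity)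
  refine le_of_mul_le_mul_left ?_ hpos
  linear_combination key

/-- Eliminating $d_2$ and completing the square gives $c_1\ge\frac{4m^2+4m-1}{8}d_0^2$. Comparison
with $c_m=m(m+1)d_m^2$ needs $(d_0/d_m)^2$ slightly above $2$, and $9/4$ is enough for $m\ge2$. -/
theorem mollSeq_self_le_one {m : ℕ} (hm : 2 ≤ m) : mollSeq m m ≤ mollSeq m 1 := by
  have h1 := three_mul_borosMollCoeff_self_le (show 1 ≤ m by omega)
  have h2 := borosMollCoeff_recurrence m le_rfl
  have h3 := borosMollCoeff_self_pos m
  have hm' : (2 : ℝ) ≤ m := by exact_mod_cast hm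
  unfold mollSeq
  rw [borosMollCoeff_of_lt (Nat.lt_succ_self m), Nat.sub_self]
  rw [Nat.sub_self] at h2
  push_cast at h2 ⊢
  generalize borosMollCoeff m m = t at *
  generalize borosMollCoeff m (1 + 1) = z at *
  generalize borosMollCoeff m 1 = x at *
  generalize borosMollCoeff m 0 = y at *
  generalize (m : ℝ) = M at *
  have h4 : 9 * t ^ 2 ≤ 4 * y ^ 2 := by
    have := pow_le_pow_left₀ (by positivity) h1 2
    linarith [mul_pow 3 t 2, mul_pow 2 y 2]
  have h5 := mul_le_mul_of_nonneg_left h4 (show 0 ≤ 4 * M ^ 2 + 4 * M - 1 by nlinarith)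
  have h6 : 0 ≤ (M ^ 2 + M - 9 / 4) * t ^ 2 := mul_nonneg (by nlinarith) (sq_nonneg t)
  have h7 := sq_nonneg (4 * x - (2 * M + 1) * y)
  linear_combination h5 / 32 + h6 / 8 + h7 / 8 + y * h2

theorem isLogConcaveSeq_mollSeq {m : ℕ} : IsLogConcaveSeq 1 m (mollSeq m) := by
  intro i hi him
  unfold zeroExtend
  by_cases h : 1 ≤ i ∧ i + 2 ≤ m
  · rw [if_pos ⟨h.1, by omega⟩, if_pos ⟨by omega, h.2⟩, if_pos ⟨by omega, by omega⟩]
    exact mollSeq_mul_le_sq (i := i + 1) (by omega) (by omega)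
  · refine le_of_eq_of_le ?_ (sq_nonneg _)
    rcases not_and_or.mp h with h | h
    · rw [if_neg (by omega), zero_mul]
    · rw [if_neg (c := 1 ≤ i + 2 ∧ i + 2 ≤ m) (by omega), mul_zero]

/-! ### Unimodality and the minimum -/

/-- By positivity and log-concavity, a descent is followed only by descents. The peak is an index of
the maximum: a strict descent before it would keep all later values below an earlier one. -/
theorem IsLogConcaveSeq.isUnimodalSeq {p q : ℕ} {a : ℕ → ℝ} (hpq : p ≤ q)
    (ha : IsLogConcaveSeq p q a) (hpos : ∀ i, p ≤ i → i ≤ q → 0 < a i) : IsUnimodalSeq p q a := by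
  obtain ⟨j, hj, hmax⟩ := Finset.exists_max_image (Finset.Icc p q) a ⟨p, by simp [hpq]⟩
  rw [Finset.mem_Icc] at hj
  have step : ∀ i, p ≤ i → i + 2 ≤ q → a i * a (i + 2) ≤ a (i + 1) ^ 2 := by
    intro i h1 h2
    have := ha i (by omega) (by omega)
    unfold zeroExtend at this
    rwa [if_pos ⟨h1, by omega⟩, if_pos ⟨by omega, h2⟩, if_pos ⟨by omega, by omega⟩] at this
  have down : ∀ i, p ≤ i → i + 2 ≤ q → a (i + 1) ≤ a i → a (i + 2) ≤ a (i + 1) := by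
    intro i h1 h2 h3
    have h4 := step i h1 h2
    have h5 := hpos i h1 (by omega)
    have h6 := hpos (i + 1) (by omega) (by omega)
    by_contra! h7
    nlinarith
  refine ⟨j, hj.1, hj.2, ?_, ?_⟩
  · intro i hi hij
    by_contra! h
    have h8 : ∀ n, i + 1 + n ≤ q → a (i + 1 + n) ≤ a (i + n) ∧ a (i + 1 + n) < a i := by
      intro n
      induction n with
      | zero => exact fun _ => ⟨h.le, h⟩
      | succ n ih =>
        intro hn
        obtain ⟨h9, h10⟩ := ih (by omega)
        have h11 := down (i + n) (by omega) (by omega) (by rwa [add_right_comm])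
        rw [show i + 1 + (n + 1) = i + n + 2 by ring, show i + (n + 1) = i + n + 1 by ring]
        rw [add_right_comm i 1 n] at h10
        exact ⟨h11, h11.trans_lt h10⟩
    have h12 := (h8 (j - (i + 1)) (by omega)).2
    rw [show i + 1 + (j - (i + 1)) = j by omega] at h12
    have := hmax i (Finset.mem_Icc.mpr ⟨hi, by omega⟩)
    linarith
  · intro i hi hiq
    induction i, hi using Nat.le_induction with
    | base => exact hmax (j + 1) (Finset.mem_Icc.mpr ⟨by omega, by omega⟩)
    | succ n hn ih => exact down n (by omega) (by omega) (ih (by omega))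

theorem IsUnimodalSeq.min_le {p q i : ℕ} {a : ℕ → ℝ} (ha : IsUnimodalSeq p q a) (hpi : p ≤ i)
    (hiq : i ≤ q) : min (a p) (a q) ≤ a i := by
  obtain ⟨j, -, -, hup, hdown⟩ := ha
  rcases le_total i j with h | h
  · refine (min_le_left _ _).trans ?_
    induction i, hpi using Nat.le_induction with
    | base => exact le_rfl
    | succ n hn ih => exact (ih (by omega) (by omega)).trans (hup n hn (by omega))
  · refine (min_le_right _ _).trans ?_
    induction hiq using Nat.decreasingInduction with
    | self => exact le_rfl
    | of_succ n hn ih => exact (ih (by omega) (by omega)).trans (hdown n h (by omega))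

theorem theorem1p7 (m : ℕ) (hm : 2 ≤ m) :
    IsLogConcaveSeq 1 m (mollSeq m) ∧
    IsUnimodalSeq 1 m (mollSeq m) ∧
    (∀ i : ℕ, 1 ≤ i → i ≤ m → mollSeq m m ≤ mollSeq m i) ∧
    mollSeq m m = (m : ℝ) * ((m : ℝ) + 1) * ((2 * m).choose m : ℝ) ^ 2 / 2 ^ (2 * m) := by
  have h1 := isLogConcaveSeq_mollSeq (m := m)
  have h2 := h1.isUnimodalSeq (by omega) fun i hi him => mollSeq_pos hm hi him
  refine ⟨h1, h2, fun i hi him => ?_, mollSeq_self m⟩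
  have h3 := h2.min_le hi him
  rwa [min_eq_right (mollSeq_self_le_one hm)] at h3
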